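/- Let $X$ be a compact Hausdorff space (not necessarily metrizable), let $C(X)$ be the C*-algebra of continuous complex-valued functions on $X$, and let $G \subset C(X)$ be a subset which contains the constant function $1$ and separates the points of $X$. Let $A = \overline{\operatorname{span}(G \cup G^*)}$ be the function system in $C(X)$ determined by $G$, let $S(A)$ be the convex set of all states (unital positive linear functionals) of $A$, and let the Choquet boundary $\partial_A X$ be the set of all $x \in X$ such that the evaluation $a \mapsto a(x)$ is an extreme point of $S(A)$. Then the following are equivalent: 1. $\partial_A X = X$. 2. $G$ is a Korovkin set: for every net of positive linear maps $\phi_\lambda : C(X) \to C(X)$ such that $\lim_\lambda \|\phi_\lambda(g) - g\| = 0$ for all $g \in G$, one has $\lim_\lambda \|\phi_\lambda(f) - f\| = 0$ for all $f \in C(X)$. 3. For every compact Hausdorff space $Y$, every unital $*$-homomorphism $\pi : C(X) \to C(Y)$ and every net of positive linear maps $\phi_\lambda : C(X) \to C(Y)$ such that $\lim_\lambda \phi_\lambda(g) = \pi(g)$ in norm for all $g \in G$, one has $\lim_\lambda \phi_\lambda(f) = \pi(f)$ in norm for all $f \in C(X)$. If $X$ is metrizable, then in (2) it is equivalent to consider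 only sequences $(\phi_n)_{n \ge 1}$ of positive linear maps in place of nets. -/

import Mathlib

open Filter Topology
open scoped ComplexOrder

universe u v w

namespace Saskin

variable {X : Type u} [TopologicalSpace X] [CompactSpace X]

/-- The function system in `C(X)` determined by a set `G`: the norm closure of the complex linear
span of `G ∪ G*`, where `G* = {conj g : g ∈ G}`. -/
noncomputable def functionSystem (G : Set C(X, ℂ)) : Submodule ℂ C(X, ℂ) :=
  (Submodule.span ℂ (G ∪ star '' G)).topologicalClosure

/-- The state space `S(A)`: the unital positive linear functionals on `A ⊆ C(X)`.
(The constant function `1` belongs to every function system `A`.) -/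
noncomputable def stateSpace (A : Submodule ℂ C(X, ℂ)) : Set (A →ₗ[ℂ] ℂ) :=
  {φ | (∀ a : A, (a : C(X, ℂ)) = 1 → φ a = 1) ∧ ∀ a : A, 0 ≤ (a : C(X, ℂ)) → 0 ≤ φ a}

/-- The point evaluation `a ↦ a x`, as a linear functional on `A`. -/
noncomputable def pointEval (A : Submodule ℂ C(X, ℂ)) (x : X) : A →ₗ[ℂ] ℂ where
  toFun a := (a : C(X, ℂ)) x
  map_add' _ _ := rfl
  map_smul' _ _ := rfl

/-- The Choquet boundary `∂_A X`: the points of `X` whose evaluation functional is an extreme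
point of the convex set `S(A)`. -/
noncomputable def choquetBoundary (A : Submodule ℂ C(X, ℂ)) : Set X :=
  {x | pointEval A x ∈ (stateSpace A).extremePoints ℝ}

/-- `G` is a Korovkin set: any net of positive linear maps `C(X) → C(X)` which converges
pointwise in norm to the identity on `G` does so on all of `C(X)`. -/
def IsKorovkinSet (G : Set C(X, ℂ)) : Prop :=
  ∀ (ι : Type (max u w)) [Preorder ι] [IsDirectedOrder ι] [Nonempty ι]
    (φ : ι → (C(X, ℂ) →ₚ[ℂ] C(X, ℂ))),
    (∀ g ∈ G, Tendsto (fun i => ‖φ i g - g‖) atTop (𝓝 0)) →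
      ∀ f : C(X, ℂ), Tendsto (fun i => ‖φ i f - f‖) atTop (𝓝 0)

/-- The same property for sequences of positive linear maps, as used for metrizable `X`. -/
def IsSeqKorovkinSet (G : Set C(X, ℂ)) : Prop :=
  ∀ φ : ℕ → (C(X, ℂ) →ₚ[ℂ] C(X, ℂ)),
    (∀ g ∈ G, Tendsto (fun n => ‖φ n g - g‖) atTop (𝓝 0)) →
      ∀ f : C(X, ℂ), Tendsto (fun n => ‖φ n f - f‖) atTop (𝓝 0)

/-- For any compact Hausdorff `Y`, any unital `*`-homomorphism `π : C(X) → C(Y)` and any net of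
positive linear maps `C(X) → C(Y)`, pointwise norm convergence to `π` on `G` implies pointwise
norm convergence to `π` on all of `C(X)`. -/
def ConvergesToStarHoms (G : Set C(X, ℂ)) : Prop :=
  ∀ (Y : Type v) [TopologicalSpace Y] [CompactSpace Y] [T2Space Y]
    (π : C(X, ℂ) →⋆ₐ[ℂ] C(Y, ℂ))
    (ι : Type w) [Preorder ι] [IsDirectedOrder ι] [Nonempty ι]
    (φ : ι → (C(X, ℂ) →ₚ[ℂ] C(Y, ℂ))),
    (∀ g ∈ G, Tendsto (fun i => φ i g) atTop (𝓝 (π g))) →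
      ∀ f : C(X, ℂ), Tendsto (fun i => φ i f) atTop (𝓝 (π f))

end Saskin

/-! Every condition is equivalent to unique extension, `HasUniqueExtensions`. It gives convergence
by compactness (`HasUniqueExtensions.tendsto`): if convergence fails at `f`, follow the maps at
points where they stay away from `π f`; an ultrafilter limit is a positive functional that agrees on
`G`, but not at `f`, with a point evaluation. Conversely, a second extension `Φ` at `x` yields the
maps `f ↦ (1 - h) f + Φ(f) h`, with bumps `h` shrinking to `x`, which converge to the identity on
`G` only.

For the Choquet boundary, states extend to `C(X)` by Riesz extension, where point evaluations are
extreme, so uniqueness gives extremality. Conversely, extremality forces `Φ (h * a) = Φ h * a x` on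
the function system; the elements with this property form a closed star subalgebra, which is
everything by Stone–Weierstrass. -/

namespace Saskin

/-! ### Unique extension implies convergence -/

section PositiveMaps

variable {X : Type*} [TopologicalSpace X] [CompactSpace X]

theorem norm_apply_le_four_mul {Y : Type*} [TopologicalSpace Y] [CompactSpace Y]
    (φ : C(X, ℂ) →ₚ[ℂ] C(Y, ℂ)) (f : C(X, ℂ)) : ‖φ f‖ ≤ 4 * (‖φ 1‖ * ‖f‖) := by
  obtain ⟨y, hy_nonneg, hy_norm, hy⟩ := CStarAlgebra.exists_sum_four_nonneg f
  conv_lhs => rw [hy]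
  simp only [map_sum, map_smul]
  refine (norm_sum_le _ _).trans ?_
  simp only [norm_smul, norm_pow, Complex.norm_I, one_pow, one_mul]
  refine (Finset.sum_le_sum (g := fun _ ↦ ‖φ 1‖ * ‖f‖) fun i _ ↦ ?_).trans (by simp)
  refine (φ.norm_apply_le_of_nonneg _ (hy_nonneg i)).trans ?_
  gcongr
  exact hy_norm i

/-- Every character of `C(X)` composed with a unital `*`-homomorphism into `C(Y)` is a point
evaluation. -/
theorem exists_eval_eq {Y : Type*} [T2Space X] [TopologicalSpace Y] [CompactSpace Y]
    (π : C(X, ℂ) →⋆ₐ[ℂ] C(Y, ℂ)) (y : Y) : ∃ x : X, ∀ f, π f y = f x := by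
  let χ : WeakDual.characterSpace ℂ C(X, ℂ) :=
    WeakDual.CharacterSpace.equivAlgHom.symm
      ((ContinuousMap.evalAlgHom ℂ ℂ y).comp π.toAlgHom)
  obtain ⟨x, hx⟩ := (WeakDual.CharacterSpace.continuousMapEval_bijective X ℂ).2 χ
  exact ⟨x, fun f ↦ (DFunLike.congr_fun hx f).symm⟩

/-- Each point evaluation is the only positive functional on `C(X)` with the given values
on `G`. -/
def HasUniqueExtensions (G : Set C(X, ℂ)) : Prop :=
  ∀ (x : X) (Φ : C(X, ℂ) →ₚ[ℂ] ℂ), (∀ g ∈ G, Φ g = g x) → ∀ f, Φ f = f x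

theorem exists_tendsto_ultrafilter {ι : Type*} (F : Ultrafilter ι) (u : ι → ℂ) (C : ℝ)
    (h : ∀ᶠ i in (F : Filter ι), ‖u i‖ ≤ C) : ∃ c, Tendsto u F (𝓝 c) := by
  have hF : Metric.closedBall (0 : ℂ) C ∈ F.map u :=
    h.mono fun i hi ↦ mem_closedBall_zero_iff.2 hi
  obtain ⟨c, -, hc⟩ := (isCompact_closedBall (0 : ℂ) C).ultrafilter_le_nhds' _ hF
  exact ⟨c, hc⟩

theorem HasUniqueExtensions.tendsto [T2Space X] {G : Set C(X, ℂ)} (hG : HasUniqueExtensions G)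
    (h_one : (1 : C(X, ℂ)) ∈ G) {Y : Type*} [TopologicalSpace Y] [CompactSpace Y]
    (π : C(X, ℂ) →⋆ₐ[ℂ] C(Y, ℂ)) {ι : Type*} {l : Filter ι}
    {φ : ι → (C(X, ℂ) →ₚ[ℂ] C(Y, ℂ))} (h : ∀ g ∈ G, Tendsto (fun i ↦ φ i g) l (𝓝 (π g)))
    (f : C(X, ℂ)) : Tendsto (fun i ↦ φ i f) l (𝓝 (π f)) := by
  rw [Metric.tendsto_nhds]
  by_contra! hcon
  obtain ⟨ε, hε, hfreq⟩ := hcon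
  have hne := frequently_iff_neBot.1 hfreq
  obtain ⟨F, hFle⟩ := Ultrafilter.exists_le (l ⊓ 𝓟 {i | ε ≤ dist (φ i f) (π f)})
  have hFl : (F : Filter ι) ≤ l := hFle.trans inf_le_left
  have hFs : ∀ᶠ i in (F : Filter ι), ε ≤ dist (φ i f) (π f) :=
    hFle.trans inf_le_right (mem_principal_self _)
  have hex (i : ι) (hi : ε ≤ dist (φ i f) (π f)) : ∃ y, ε ≤ dist (φ i f y) (π f y) := by
    by_contra! hlt
    exact hi.not_gt ((ContinuousMap.dist_lt_iff hε).2 hlt)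
  obtain ⟨i₀, hi₀⟩ := hFs.exists
  obtain ⟨y₀, -⟩ := hex i₀ hi₀
  have : ∀ i, ∃ y, ε ≤ dist (φ i f) (π f) → ε ≤ dist (φ i f y) (π f y) := by
    intro i
    by_cases hi : ε ≤ dist (φ i f) (π f)
    · obtain ⟨y, hy⟩ := hex i hi
      exact ⟨y, fun _ ↦ hy⟩
    · exact ⟨y₀, fun h ↦ (hi h).elim⟩
  choose y hy using this
  obtain ⟨z, -, hz⟩ := isCompact_univ.ultrafilter_le_nhds' (F.map y) univ_mem
  have hz : Tendsto y F (𝓝 z) := hz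
  -- Convergence at `1` bounds the maps eventually, so all ultrafilter limits exist.
  have hbound : ∀ᶠ i in (F : Filter ι), ‖φ i 1‖ ≤ ‖π 1‖ + 1 :=
    (((h 1 h_one).mono_left hFl).norm.eventually (gt_mem_nhds (lt_add_one _))).mono
      fun _ ↦ le_of_lt
  have hlim (a : C(X, ℂ)) : ∃ c, Tendsto (fun i ↦ φ i a (y i)) F (𝓝 c) := by
    refine exists_tendsto_ultrafilter F _ (4 * ((‖π 1‖ + 1) * ‖a‖)) ?_
    filter_upwards [hbound] with i hi
    refine ((φ i a).norm_coe_le_norm _).trans ((norm_apply_le_four_mul _ _).trans ?_)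
    gcongr
  choose Λ hΛ using hlim
  let Φ : C(X, ℂ) →ₚ[ℂ] ℂ := PositiveLinearMap.mk₀
    { toFun := Λ
      map_add' := fun a b ↦ tendsto_nhds_unique (hΛ (a + b))
        (((hΛ a).add (hΛ b)).congr fun i ↦ by simp)
      map_smul' := fun c a ↦ tendsto_nhds_unique (hΛ (c • a))
        (((hΛ a).const_smul c).congr fun i ↦ by simp) }
    fun a ha ↦ ge_of_tendsto' (hΛ a) fun i ↦ (φ i).map_nonneg ha (y i)
  have heval (u : C(Y, ℂ)) : Tendsto (fun i ↦ u (y i)) F (𝓝 (u z)) :=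
    (u.continuous.tendsto z).comp hz
  obtain ⟨x, hx⟩ := exists_eval_eq π z
  have hΦ : Λ f = f x := by
    refine hG x Φ (fun g hg ↦ ?_) f
    rw [← hx]
    have h0 : Tendsto (fun i ↦ φ i g (y i) - π g (y i)) F (𝓝 0) := by
      refine squeeze_zero_norm (fun i ↦ ?_)
        (tendsto_iff_norm_sub_tendsto_zero.1 ((h g hg).mono_left hFl))
      exact (φ i g - π g).norm_coe_le_norm (y i)
    exact tendsto_nhds_unique (hΛ g) (by simpa using h0.add (heval (π g)))
  have hlast : Tendsto (fun i ↦ dist (φ i f (y i)) (π f (y i))) F (𝓝 0) := by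
    have := (hΛ f).dist (heval (π f))
    rwa [hΦ, hx, dist_self] at this
  obtain ⟨i, hi, hi'⟩ := ((hlast.eventually (gt_mem_nhds hε)).and hFs).exists
  exact absurd (hy i hi') (not_le.2 hi)

end PositiveMaps

/-! ### Perturbing the identity near a point -/

section Perturbation

variable {X : Type*} [TopologicalSpace X]

/-- The positive map `f ↦ (1 - h) f + Φ(f) h`. -/
noncomputable def perturbId (Φ : C(X, ℂ) →ₚ[ℂ] ℂ) (h : C(X, ℂ)) (h0 : 0 ≤ h) (h1 : h ≤ 1) :
    C(X, ℂ) →ₚ[ℂ] C(X, ℂ) :=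
  PositiveLinearMap.mk₀
    (LinearMap.mulLeft ℂ (1 - h) + (Φ.toLinearMap.smulRight h)) fun f hf ↦ by
      intro x
      have := Φ.map_nonneg hf
      have h1x : 0 ≤ 1 - h x := sub_nonneg.2 (h1 x)
      simpa using add_nonneg (mul_nonneg h1x (hf x)) (mul_nonneg this (h0 x))

theorem perturbId_apply_sub (Φ : C(X, ℂ) →ₚ[ℂ] ℂ) (h : C(X, ℂ)) (h0 : 0 ≤ h) (h1 : h ≤ 1)
    (f : C(X, ℂ)) (x : X) : (perturbId Φ h h0 h1 f - f) x = h x * (Φ f - f x) := by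
  change (1 - h x) * f x + Φ f * h x - f x = _
  ring

theorem exists_bump [CompactSpace X] [T2Space X] {x : X} {U : Set X} (hU : U ∈ 𝓝 x) :
    ∃ h : C(X, ℂ), 0 ≤ h ∧ h ≤ 1 ∧ h x = 1 ∧ ∀ z ∉ U, h z = 0 := by
  obtain ⟨k, hk0, hk1, hk⟩ := exists_continuous_zero_one_of_isClosed
    (s := (interior U)ᶜ) (t := {x}) isOpen_interior.isClosed_compl isClosed_singleton
    (by simpa using mem_interior_iff_mem_nhds.2 hU)
  refine ⟨⟨fun z ↦ (k z : ℂ), by fun_prop⟩, fun z ↦ ?_, fun z ↦ ?_, ?_, fun z hz ↦ ?_⟩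
  · exact Complex.zero_le_real.2 (hk z).1
  · simpa using Complex.real_le_real.2 (hk z).2
  · simpa using hk1 (Set.mem_singleton x)
  · simpa using hk0 fun hz' ↦ hz (interior_subset hz')

/-- If positive perturbations of the identity supported in shrinking neighbourhoods of `x` that
converge on `G` also converge everywhere, then `x` has the unique extension property. -/
theorem apply_eq_eval_of_forall_tendsto [CompactSpace X] [T2Space X] {G : Set C(X, ℂ)}
    {ι : Type*} {l : Filter ι} [l.NeBot] {x : X} {U : ι → Set X} (hUx : ∀ i, U i ∈ 𝓝 x)
    (hl : ∀ V ∈ 𝓝 x, ∀ᶠ i in l, U i ⊆ V)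
    (hK : ∀ φ : ι → (C(X, ℂ) →ₚ[ℂ] C(X, ℂ)),
      (∀ g ∈ G, Tendsto (fun i ↦ ‖φ i g - g‖) l (𝓝 0)) →
        ∀ f : C(X, ℂ), Tendsto (fun i ↦ ‖φ i f - f‖) l (𝓝 0))
    (Φ : C(X, ℂ) →ₚ[ℂ] ℂ) (hΦ : ∀ g ∈ G, Φ g = g x) (f : C(X, ℂ)) : Φ f = f x := by
  choose h h0 h1 hx hU using fun i ↦ exists_bump (hUx i)
  have hh (i : ι) (z : X) : ‖h i z‖ ≤ 1 := by
    simpa using CStarAlgebra.norm_le_norm_of_nonneg_of_le (h0 i z) (h1 i z)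
  have key := hK (fun i ↦ perturbId Φ (h i) (h0 i) (h1 i)) (fun g hg ↦ ?_) f
  · have hle (i : ι) : ‖Φ f - f x‖ ≤ ‖perturbId Φ (h i) (h0 i) (h1 i) f - f‖ := by
      have := (perturbId Φ (h i) (h0 i) (h1 i) f - f).norm_coe_le_norm x
      rwa [perturbId_apply_sub, hx, one_mul] at this
    exact sub_eq_zero.1 (norm_le_zero_iff.1 (ge_of_tendsto' key hle))
  · rw [Metric.tendsto_nhds]
    intro ε hε
    have hV : {z | dist (g z) (g x) < ε / 2} ∈ 𝓝 x :=
      g.continuous.continuousAt (Metric.ball_mem_nhds (g x) (half_pos hε))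
    filter_upwards [hl _ hV] with i hi
    rw [dist_zero_right, norm_norm]
    refine lt_of_le_of_lt ?_ (half_lt_self hε)
    rw [ContinuousMap.norm_le _ (half_pos hε).le]
    intro z
    rw [perturbId_apply_sub, hΦ g hg]
    by_cases hz : z ∈ U i
    · rw [norm_mul, ← dist_eq_norm, dist_comm]
      exact (mul_le_of_le_one_left dist_nonneg (hh i z)).trans (hi hz).le
    · rw [hU i z hz, zero_mul, norm_zero]
      exact (half_pos hε).le

end Perturbation

/-! ### Extension of states and the Choquet boundary -/

section FunctionSystem

variable {X : Type*} [TopologicalSpace X] [CompactSpace X]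

theorem subset_functionSystem (G : Set C(X, ℂ)) :
    G ⊆ (functionSystem G : Set C(X, ℂ)) := fun _ hg ↦
  Submodule.le_topologicalClosure _ (Submodule.subset_span (Or.inl hg))

theorem star_mem_functionSystem {G : Set C(X, ℂ)} {a : C(X, ℂ)} (ha : a ∈ functionSystem G) :
    star a ∈ functionSystem G := by
  have hspan : ∀ b ∈ Submodule.span ℂ (G ∪ star '' G),
      star b ∈ Submodule.span ℂ (G ∪ star '' G) := by
    intro b hb
    induction hb using Submodule.span_induction with
    | mem b hb =>
      refine Submodule.subset_span ?_
      rcases hb with hb | ⟨c, hc, rfl⟩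
      · exact Or.inr ⟨b, hb, rfl⟩
      · exact Or.inl (by rwa [star_star])
    | zero => simp
    | add b c _ _ hb hc => rw [star_add]; exact add_mem hb hc
    | smul r b _ hb => rw [star_smul]; exact Submodule.smul_mem _ _ hb
  exact map_mem_closure continuous_star ha hspan

theorem apply_eq_eval_of_mem_functionSystem {G : Set C(X, ℂ)} {x : X} {Φ : C(X, ℂ) →ₚ[ℂ] ℂ}
    (hΦ : ∀ g ∈ G, Φ g = g x) {a : C(X, ℂ)} (ha : a ∈ functionSystem G) : Φ a = a x := by
  have hclosed : IsClosed {a : C(X, ℂ) | Φ a = a x} :=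
    isClosed_eq (map_continuous Φ) (continuous_eval_const x)
  refine closure_minimal (fun b hb ↦ ?_) hclosed ha
  induction hb using Submodule.span_induction with
  | mem b hb =>
    rcases hb with hb | ⟨c, hc, rfl⟩
    · exact hΦ b hb
    · simp [map_star, hΦ c hc]
  | zero => simp
  | add b c _ _ hb hc => simpa using congr_arg₂ (· + ·) hb hc
  | smul r b _ hb => simpa using Or.inl hb

/-- States of a function system extend to positive functionals on `C(X)`. -/
theorem exists_positive_extension {A : Submodule ℂ C(X, ℂ)} (h_one : (1 : C(X, ℂ)) ∈ A)
    (h_star : ∀ a ∈ A, star a ∈ A) {φ : A →ₗ[ℂ] ℂ} (hφ : φ ∈ stateSpace A) :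
    ∃ Φ : C(X, ℂ) →ₚ[ℂ] ℂ, ∀ a : A, Φ a = φ a := by
  have hone : φ ⟨1, h_one⟩ = 1 := hφ.1 _ rfl
  have hsa (a : A) (ha : IsSelfAdjoint (a : C(X, ℂ))) : (φ a).im = 0 := by
    have h := hφ.2 (a + ((‖(a : C(X, ℂ))‖ : ℝ) : ℂ) • ⟨1, h_one⟩) (by
      intro x
      have h1 := neg_le_iff_add_nonneg.1 (IsSelfAdjoint.neg_algebraMap_norm_le_self ha)
      simpa [add_comm, Algebra.algebraMap_eq_smul_one] using h1 x)
    rw [map_add, map_smul, hone] at h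
    simpa using (Complex.le_def.1 h).2.symm
  -- Constraining only the real part lets one cone on all of `C(X)` give positivity and, as it
  -- contains `±I • f` for real `f`, real values on real functions.
  let s : PointedCone ℝ C(X, ℂ) :=
    { carrier := {f | ∀ x, 0 ≤ (f x).re}
      add_mem' := fun hf hg x ↦ by simpa using add_nonneg (hf x) (hg x)
      zero_mem' := fun x ↦ by simp
      smul_mem' := fun c f hf x ↦ by
        change 0 ≤ (((c : ℝ) • f x : ℂ)).re
        rw [Complex.smul_re]
        exact mul_nonneg c.2 (hf x) }
  let p : C(X, ℂ) →ₗ.[ℝ] ℝ :=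
    ⟨A.restrictScalars ℝ, Complex.reLm.comp (φ.restrictScalars ℝ)⟩
  have hnonneg (a : p.domain) (ha : (a : C(X, ℂ)) ∈ s) : 0 ≤ p a := by
    let b : A := ⟨star a, h_star _ a.2⟩
    let a' : A := a
    have h1 := (Complex.le_def.1 (hφ.2 (a' + b) (by
      intro x
      have : 0 ≤ ((a : C(X, ℂ)) x).re := ha x
      change 0 ≤ (a : C(X, ℂ)) x + star ((a : C(X, ℂ)) x)
      rw [Complex.star_def, Complex.add_conj, Complex.zero_le_real]
      linarith))).1
    have h2 := hsa (Complex.I • (a' - b)) (by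
      change star (Complex.I • ((a : C(X, ℂ)) - star (a : C(X, ℂ)))) =
        Complex.I • ((a : C(X, ℂ)) - star (a : C(X, ℂ)))
      rw [star_smul, star_sub, star_star, Complex.star_def, Complex.conj_I]
      module)
    simp at h1 h2
    change 0 ≤ (φ a').re
    linarith
  have hdense (f : C(X, ℂ)) : ∃ a : p.domain, (a : C(X, ℂ)) + f ∈ s := by
    refine ⟨⟨(‖f‖ : ℂ) • 1, A.smul_mem _ h_one⟩, fun x ↦ ?_⟩
    have := (Complex.abs_re_le_norm (f x)).trans (f.norm_coe_le_norm x)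
    have := neg_abs_le (f x).re
    simp
    linarith
  obtain ⟨F, hFp, hFs⟩ := riesz_extension s p hnonneg hdense
  have hre (f : C(X, ℂ)) : (Module.Dual.extendRCLike (𝕜 := ℂ) F f).re = F f :=
    Module.Dual.re_extendRCLike_apply (𝕜 := ℂ) F f
  have him (f : C(X, ℂ)) : (Module.Dual.extendRCLike (𝕜 := ℂ) F f).im = - F (Complex.I • f) :=
    Module.Dual.im_extendRCLike_apply (𝕜 := ℂ) F f
  refine ⟨PositiveLinearMap.mk₀ (Module.Dual.extendRCLike (𝕜 := ℂ) F) fun f hf ↦ ?_, fun a ↦ ?_⟩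
  · have hf' (x : X) := Complex.le_def.1 (hf x)
    have h1 : 0 ≤ F (Complex.I • f) := hFs _ fun x ↦ by simpa using (hf' x).2.ge
    have h2 : 0 ≤ F (-(Complex.I • f)) := hFs _ fun x ↦ by simpa using (hf' x).2.le
    rw [map_neg] at h2
    refine Complex.le_def.2 ⟨?_, ?_⟩
    · rw [hre]
      exact hFs f fun x ↦ (hf' x).1
    · rw [him]
      simp only [Complex.zero_im]
      linarith
  · have hF (b : A) : F b = (φ b).re := hFp b
    refine Complex.ext ((hre _).trans (hF a)) ((him _).trans ?_)
    have := hF (Complex.I • a)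
    rw [map_smul] at this
    simp only [Submodule.coe_smul] at this
    rw [this]
    simp

omit [CompactSpace X] in
theorem pointEval_mem_stateSpace (A : Submodule ℂ C(X, ℂ)) (x : X) :
    pointEval A x ∈ stateSpace A :=
  ⟨fun a ha ↦ by change (a : C(X, ℂ)) x = 1; simp [ha], fun _ ha ↦ ha x⟩

/-- Point evaluations are extreme among the states of `C(X)`. -/
theorem apply_eq_of_combination_eq_eval {x : X} {Φ Ψ : C(X, ℂ) →ₚ[ℂ] ℂ} {s t : ℝ} (hs : 0 < s)
    (ht : 0 ≤ t) (h : ∀ f : C(X, ℂ), s • Φ f + t • Ψ f = f x) (hΦ : Φ 1 = 1) (f : C(X, ℂ)) :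
    Φ f = f x := by
  have hpos (p : C(X, ℂ)) (hp : 0 ≤ p) : Φ p = p x := by
    -- `k` vanishes at `x`, so `Φ k = 0`, and it dominates `±(p - p x)`.
    let k : C(X, ℂ) := ⟨fun z ↦ (‖p z - p x‖ : ℂ), by fun_prop⟩
    have hk0 : 0 ≤ k := fun z ↦ Complex.zero_le_real.2 (norm_nonneg _)
    have hkx : k x = 0 := by simp [k]
    have hk : Φ k = 0 := by
      have h1 := h k
      rw [hkx] at h1
      have h2 := ((add_eq_zero_iff_of_nonneg (smul_nonneg hs.le (Φ.map_nonneg hk0))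
        (smul_nonneg ht (Ψ.map_nonneg hk0))).1 h1).1
      exact (smul_eq_zero.1 h2).resolve_left hs.ne'
    have him (z : X) : (p z).im = 0 := (Complex.le_def.1 (hp z)).2.symm
    have hle1 : p - p x • (1 : C(X, ℂ)) ≤ k := fun z ↦ Complex.le_def.2
      ⟨by simpa [k] using Complex.re_le_norm (p z - p x), by simp [k, him]⟩
    have hle2 : -(p - p x • (1 : C(X, ℂ))) ≤ k := fun z ↦ Complex.le_def.2
      ⟨by simpa [k, norm_sub_rev] using Complex.re_le_norm (-(p z - p x)), by simp [k, him]⟩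
    have h1 := OrderHomClass.mono Φ hle1
    have h2 := OrderHomClass.mono Φ hle2
    simp only [hk, map_sub, map_smul, hΦ, smul_eq_mul, mul_one, neg_sub] at h1 h2
    exact le_antisymm (sub_nonpos.1 h1) (sub_nonpos.1 h2)
  obtain ⟨y, hy, -, hf⟩ := CStarAlgebra.exists_sum_four_nonneg f
  rw [hf]
  simp [map_sum, hpos _ (hy _)]

theorem HasUniqueExtensions.choquetBoundary_eq_univ {G : Set C(X, ℂ)}
    (hG : HasUniqueExtensions G) (h_one : (1 : C(X, ℂ)) ∈ G) :
    choquetBoundary (functionSystem G) = Set.univ := by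
  refine Set.eq_univ_of_forall fun x ↦ ⟨pointEval_mem_stateSpace _ x, ?_⟩
  rintro φ hφ ψ hψ ⟨s, t, hs, ht, -, hst⟩
  have h1 := subset_functionSystem G h_one
  obtain ⟨Φ, hΦ⟩ := exists_positive_extension h1 (fun _ ↦ star_mem_functionSystem) hφ
  obtain ⟨Ψ, hΨ⟩ := exists_positive_extension h1 (fun _ ↦ star_mem_functionSystem) hψ
  let Θ : C(X, ℂ) →ₚ[ℂ] ℂ := PositiveLinearMap.mk₀
    (s • Φ.toLinearMap + t • Ψ.toLinearMap) fun f hf ↦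
      add_nonneg (smul_nonneg hs.le (Φ.map_nonneg hf)) (smul_nonneg ht.le (Ψ.map_nonneg hf))
  have hΘ : ∀ f, s • Φ f + t • Ψ f = f x := hG x Θ fun g hg ↦ by
    have hg' := subset_functionSystem G hg
    change s • Φ g + t • Ψ g = g x
    rw [hΦ ⟨g, hg'⟩, hΨ ⟨g, hg'⟩]
    exact DFunLike.congr_fun hst ⟨g, hg'⟩
  have hΦ1 : Φ 1 = 1 := (hΦ ⟨1, h1⟩).trans (hφ.1 _ rfl)
  ext a
  rw [← hΦ]
  exact apply_eq_of_combination_eq_eval hs ht.le hΘ hΦ1 a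

/-- The functional `a ↦ Φ(h a) / t` on `A`. -/
noncomputable def weightedFunctional (A : Submodule ℂ C(X, ℂ)) (Φ : C(X, ℂ) →ₚ[ℂ] ℂ)
    (h : C(X, ℂ)) (t : ℝ) : A →ₗ[ℂ] ℂ :=
  (t : ℂ)⁻¹ • (Φ.toLinearMap ∘ₗ LinearMap.mulLeft ℂ h ∘ₗ A.subtype)

omit [CompactSpace X] in
theorem weightedFunctional_apply (A : Submodule ℂ C(X, ℂ)) (Φ : C(X, ℂ) →ₚ[ℂ] ℂ)
    (h : C(X, ℂ)) (t : ℝ) (a : A) :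
    weightedFunctional A Φ h t a = (t : ℂ)⁻¹ * Φ (h * a) := rfl

omit [CompactSpace X] in
theorem weightedFunctional_mem_stateSpace {A : Submodule ℂ C(X, ℂ)} {Φ : C(X, ℂ) →ₚ[ℂ] ℂ}
    {h : C(X, ℂ)} {t : ℝ} (h0 : 0 ≤ h) (ht : 0 < t) (hΦ : Φ h = t) :
    weightedFunctional A Φ h t ∈ stateSpace A := by
  refine ⟨fun a ha ↦ ?_, fun a ha ↦ ?_⟩
  · rw [weightedFunctional_apply, ha, mul_one, hΦ]
    exact inv_mul_cancel₀ (Complex.ofReal_ne_zero.2 ht.ne')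
  · rw [weightedFunctional_apply, ← Complex.ofReal_inv]
    exact mul_nonneg (Complex.zero_le_real.2 (inv_nonneg.2 ht.le))
      (Φ.map_nonneg fun z ↦ mul_nonneg (h0 z) (ha z))

/-- For `0 ≤ k ≤ 1` with `0 < Φ k < 1`, the functionals weighted by `k` and `1 - k` are states
averaging to the evaluation at `x`, so extremality identifies both with it. Scaling and linearity
give general `h`. -/
theorem apply_mul_of_mem_choquetBoundary {A : Submodule ℂ C(X, ℂ)} {x : X}
    (hx : x ∈ choquetBoundary A) (h_one : (1 : C(X, ℂ)) ∈ A) {Φ : C(X, ℂ) →ₚ[ℂ] ℂ}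
    (hΦ : ∀ a ∈ A, Φ a = a x) (h a : C(X, ℂ)) (ha : a ∈ A) : Φ (h * a) = Φ h * a x := by
  have hΦ1 : Φ 1 = 1 := hΦ 1 h_one
  have hsub (k : C(X, ℂ)) (h0 : 0 ≤ k) (h1 : k ≤ 1) (t : ℝ) (ht0 : 0 < t) (ht1 : t < 1)
      (hk : Φ k = t) : Φ (k * a) = Φ k * a x := by
    have ht1' : 0 < 1 - t := sub_pos.2 ht1
    have heq := hx.2
      (weightedFunctional_mem_stateSpace h0 ht0 hk)
      (weightedFunctional_mem_stateSpace (A := A) (Φ := Φ) (h := 1 - k) (t := 1 - t)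
        (sub_nonneg.2 h1) ht1' (by simp [hΦ1, hk]))
      ⟨t, 1 - t, ht0, ht1', by ring, by
        ext b
        have h1 : (t : ℂ) ≠ 0 := Complex.ofReal_ne_zero.2 ht0.ne'
        have h2 : ((1 - t : ℝ) : ℂ) ≠ 0 := Complex.ofReal_ne_zero.2 ht1'.ne'
        simp only [LinearMap.add_apply, LinearMap.smul_apply, weightedFunctional_apply,
          Complex.real_smul, mul_inv_cancel_left₀ h1, mul_inv_cancel_left₀ h2]
        rw [← map_add, ← add_mul, add_sub_cancel, one_mul]
        exact hΦ b b.2⟩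
    have := DFunLike.congr_fun heq ⟨a, ha⟩
    rw [weightedFunctional_apply] at this
    rw [hk, ← show _ = a x from this, mul_inv_cancel_left₀ (Complex.ofReal_ne_zero.2 ht0.ne')]
  have hpos (p : C(X, ℂ)) (hp : 0 ≤ p) : Φ (p * a) = Φ p * a x := by
    -- The shift by `1` keeps `Φ (c • (p + 1))` positive; this `c` keeps it at most `1 / 2`.
    set c : ℝ := (2 * (‖p‖ + 1))⁻¹ with hc
    have hc0 : 0 < c := by positivity
    have hc1 : c * (‖p‖ + 1) = 1 / 2 := by rw [hc]; field_simp
    have hcp : (c : ℂ) • (p + 1) ≤ ((1 / 2 : ℝ) : ℂ) • (1 : C(X, ℂ)) := by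
      intro z
      have him : (p z).im = 0 := (Complex.le_def.1 (hp z)).2.symm
      refine Complex.le_def.2 ⟨?_, by simp [him]⟩
      have := (Complex.re_le_norm (p z)).trans (p.norm_coe_le_norm z)
      have h2 : c * ((p z).re + 1) ≤ c * (‖p‖ + 1) := by gcongr
      rw [hc1] at h2
      simpa [mul_add] using h2
    have h0 : 0 ≤ (c : ℂ) • (p + 1) :=
      smul_nonneg (Complex.zero_le_real.2 hc0.le) (add_nonneg hp zero_le_one)
    have hΦp := Complex.le_def.1 (Φ.map_nonneg hp)
    have hval : Φ ((c : ℂ) • (p + 1)) = ((c * ((Φ p).re + 1) : ℝ) : ℂ) := by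
      apply Complex.ext <;> simp [hΦ1, ← hΦp.2, mul_add]
    have hmain := hsub _ h0 (hcp.trans fun z ↦ Complex.le_def.2 ⟨by norm_num, by simp⟩)
      (c * ((Φ p).re + 1)) (mul_pos hc0 (by linarith [hΦp.1, Complex.zero_re])) (by
        have := OrderHomClass.mono Φ hcp
        rw [hval, map_smul, hΦ1] at this
        have := (Complex.le_def.1 this).1
        simp at this ⊢
        linarith) hval
    have hc0' : (c : ℂ) ≠ 0 := Complex.ofReal_ne_zero.2 hc0.ne'
    simp only [smul_mul_assoc, add_mul, one_mul, map_smul, map_add, smul_eq_mul, hΦ a ha, hΦ1,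
      mul_assoc] at hmain
    exact add_right_cancel (mul_left_cancel₀ hc0' hmain)
  obtain ⟨y, hy, -, hf⟩ := CStarAlgebra.exists_sum_four_nonneg h
  rw [hf]
  simp only [Finset.sum_mul, map_sum, smul_mul_assoc, map_smul, hpos _ (hy _), smul_eq_mul, mul_assoc]

/-- The multiplicative domain at `x` of a functional on `C(X)`. -/
noncomputable def multiplicativeDomain (Φ : C(X, ℂ) →ₚ[ℂ] ℂ) (x : X) :
    StarSubalgebra ℂ C(X, ℂ) where
  carrier := {b | ∀ h, Φ (h * b) = Φ h * b x}
  mul_mem' {b c} hb hc h := by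
    rw [← mul_assoc, hc, hb, mul_assoc, ContinuousMap.mul_apply]
  add_mem' {b c} hb hc h := by
    rw [mul_add, map_add, hb, hc, ContinuousMap.add_apply, mul_add]
  algebraMap_mem' r h := by
    simp [Algebra.algebraMap_eq_smul_one, mul_comm]
  star_mem' {b} hb h := by
    have := congr_arg star (hb (star h))
    rw [← map_star, star_mul, star_star, star_mul, ← map_star Φ, star_star] at this
    rw [mul_comm h, this, mul_comm, ContinuousMap.star_apply]

theorem hasUniqueExtensions_of_choquetBoundary_eq_univ {G : Set C(X, ℂ)}
    (h_one : (1 : C(X, ℂ)) ∈ G) (h_sep : ∀ x y : X, x ≠ y → ∃ g ∈ G, g x ≠ g y)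
    (hC : choquetBoundary (functionSystem G) = Set.univ) : HasUniqueExtensions G := by
  intro x Φ hΦ f
  have hA : ∀ a ∈ functionSystem G, Φ a = a x :=
    fun a ha ↦ apply_eq_eval_of_mem_functionSystem hΦ ha
  have hG : ∀ g ∈ G, g ∈ multiplicativeDomain Φ x := fun g hg h ↦
    apply_mul_of_mem_choquetBoundary (hC ▸ Set.mem_univ x) (subset_functionSystem G h_one) hA h g
      (subset_functionSystem G hg)
  have hsep : (multiplicativeDomain Φ x).SeparatesPoints := fun y z hyz ↦ by
    obtain ⟨g, hg, hne⟩ := h_sep y z hyz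
    exact ⟨g, ⟨g, hG g hg, rfl⟩, hne⟩
  have hclosed : IsClosed (multiplicativeDomain Φ x : Set C(X, ℂ)) := by
    have : (multiplicativeDomain Φ x : Set C(X, ℂ)) =
        ⋂ h, {b : C(X, ℂ) | Φ (h * b) = Φ h * b x} := by
      ext b
      simp [multiplicativeDomain]
    rw [this]
    refine isClosed_iInter fun h ↦ isClosed_eq ?_ ?_
    · exact (map_continuous Φ).comp (continuous_const_mul h)
    · exact continuous_const.mul (continuous_eval_const x)
  have htop := ContinuousMap.starSubalgebra_topologicalClosure_eq_top_of_separatesPoints _ hsep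
  have hf : f ∈ multiplicativeDomain Φ x := by
    have : f ∈ (multiplicativeDomain Φ x).topologicalClosure := htop ▸ StarSubalgebra.mem_top
    rwa [← SetLike.mem_coe, StarSubalgebra.topologicalClosure_coe, hclosed.closure_eq] at this
  simpa [hΦ 1 h_one] using hf 1

end FunctionSystem

/-! ### Korovkin properties and unique extension -/

section Korovkin

variable {X : Type u} [TopologicalSpace X] [CompactSpace X] [T2Space X] {G : Set C(X, ℂ)}

theorem HasUniqueExtensions.isKorovkinSet (hG : HasUniqueExtensions G)
    (h_one : (1 : C(X, ℂ)) ∈ G) : IsKorovkinSet.{u, w} G := by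
  intro ι _ _ _ φ hφ f
  rw [← tendsto_iff_norm_sub_tendsto_zero]
  exact hG.tendsto h_one (StarAlgHom.id ℂ C(X, ℂ))
    (fun g hg ↦ tendsto_iff_norm_sub_tendsto_zero.2 (hφ g hg)) f

theorem HasUniqueExtensions.isSeqKorovkinSet (hG : HasUniqueExtensions G)
    (h_one : (1 : C(X, ℂ)) ∈ G) : IsSeqKorovkinSet G := by
  intro φ hφ f
  rw [← tendsto_iff_norm_sub_tendsto_zero]
  exact hG.tendsto h_one (StarAlgHom.id ℂ C(X, ℂ))
    (fun g hg ↦ tendsto_iff_norm_sub_tendsto_zero.2 (hφ g hg)) f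

theorem HasUniqueExtensions.convergesToStarHoms (hG : HasUniqueExtensions G)
    (h_one : (1 : C(X, ℂ)) ∈ G) : ConvergesToStarHoms.{u, v, w} G :=
  fun _ _ _ _ π _ _ _ _ _ hφ f ↦ hG.tendsto h_one π hφ f

theorem IsKorovkinSet.hasUniqueExtensions (hK : IsKorovkinSet.{u, w} G) :
    HasUniqueExtensions G := by
  intro x Φ hΦ f
  -- Neighbourhoods of `x` under reverse inclusion, lifted to the universe of the nets.
  let ι : Type (max u w) := ULift.{w} (OrderDual {U : Set X // U ∈ 𝓝 x})
  have hdir : IsDirectedOrder ι := ⟨fun a b ↦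
    ⟨⟨OrderDual.toDual ⟨_, inter_mem (OrderDual.ofDual a.down).2 (OrderDual.ofDual b.down).2⟩⟩,
      Set.inter_subset_left, Set.inter_subset_right⟩⟩
  have hne : Nonempty ι := ⟨⟨OrderDual.toDual ⟨Set.univ, univ_mem⟩⟩⟩
  exact apply_eq_eval_of_forall_tendsto (l := atTop)
    (U := fun i : ι ↦ (OrderDual.ofDual i.down).1) (fun i ↦ (OrderDual.ofDual i.down).2)
    (fun V hV ↦ eventually_atTop.2 ⟨⟨OrderDual.toDual ⟨V, hV⟩⟩, fun _ hi ↦ hi⟩)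
    (fun φ ↦ hK ι φ) Φ hΦ f

theorem IsSeqKorovkinSet.hasUniqueExtensions [FirstCountableTopology X]
    (hK : IsSeqKorovkinSet G) : HasUniqueExtensions G := by
  intro x Φ hΦ f
  obtain ⟨U, hU⟩ := (𝓝 x).exists_antitone_basis
  exact apply_eq_eval_of_forall_tendsto (fun i ↦ hU.mem i)
    (fun V hV ↦ hU.eventually_subset hV) hK Φ hΦ f

omit [CompactSpace X] [T2Space X] in
-- With `Y` a point, `Φ` is itself a constant net.
theorem ConvergesToStarHoms.hasUniqueExtensions (hK : ConvergesToStarHoms.{u, v, w} G) :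
    HasUniqueExtensions G := by
  intro x Φ hΦ f
  let π : C(X, ℂ) →⋆ₐ[ℂ] C(PUnit.{v + 1}, ℂ) :=
    ContinuousMap.compStarAlgHom' ℂ ℂ (ContinuousMap.const PUnit.{v + 1} x)
  let φ : C(X, ℂ) →ₚ[ℂ] C(PUnit.{v + 1}, ℂ) :=
    PositiveLinearMap.mk₀ (Φ.toLinearMap.smulRight 1) fun f hf _ ↦ by
      simpa using Φ.map_nonneg hf
  have hφ (f : C(X, ℂ)) (y : PUnit.{v + 1}) : φ f y = Φ f := mul_one (Φ f)
  have hlim := hK PUnit.{v + 1} π PUnit.{w + 1} (fun _ ↦ φ) (fun g hg ↦ by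
    have : φ g = π g := by
      ext y
      rw [hφ, hΦ g hg]
      rfl
    rw [this]
    exact tendsto_const_nhds) f
  have := DFunLike.congr_fun (tendsto_nhds_unique tendsto_const_nhds hlim) PUnit.unit
  rwa [hφ] at this

end Korovkin

end Saskin

theorem theoremT {X : Type u} [TopologicalSpace X] [CompactSpace X] [T2Space X]
    (G : Set C(X, ℂ)) (h_one : (1 : C(X, ℂ)) ∈ G)
    (h_sep : ∀ x y : X, x ≠ y → ∃ g ∈ G, g x ≠ g y) :
    List.TFAE
      [Saskin.choquetBoundary (Saskin.functionSystem G) = Set.univ,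
        Saskin.IsKorovkinSet.{u, w} G,
        Saskin.ConvergesToStarHoms.{u, v, w} G] ∧
    (TopologicalSpace.MetrizableSpace X →
      (Saskin.IsKorovkinSet.{u, w} G ↔ Saskin.IsSeqKorovkinSet G)) := by
  have h_choquet : Saskin.choquetBoundary (Saskin.functionSystem G) = Set.univ ↔
      Saskin.HasUniqueExtensions G :=
    ⟨Saskin.hasUniqueExtensions_of_choquetBoundary_eq_univ h_one h_sep,
      fun h ↦ h.choquetBoundary_eq_univ h_one⟩
  have h_net : Saskin.IsKorovkinSet.{u, w} G ↔ Saskin.HasUniqueExtensions G :=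
    ⟨fun h ↦ h.hasUniqueExtensions, fun h ↦ h.isKorovkinSet h_one⟩
  have h_hom : Saskin.ConvergesToStarHoms.{u, v, w} G ↔ Saskin.HasUniqueExtensions G :=
    ⟨fun h ↦ h.hasUniqueExtensions, fun h ↦ h.convergesToStarHoms h_one⟩
  refine ⟨?_, fun _ ↦ h_net.trans
    ⟨fun h ↦ h.isSeqKorovkinSet h_one, fun h ↦ h.hasUniqueExtensions⟩⟩
  rw [h_choquet, h_net, h_hom]
  tfae_finish
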